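/- **Proposition 3.1.** Let $A$ be a graded $C^*$-algebra with grading automorphism $\alpha$ (a $*$-automorphism with $\alpha^2=\mathrm{id}$; $A_n=\{a:\alpha(a)=(-1)^na\}$), let $C_0(\mathbb R)$ be graded by even and odd functions, and let $\phi : C_0(\mathbb R)\to A$ be a graded $*$-homomorphism. Regard $A$ as a right Hilbert $A$-module with $\langle x,y\rangle=x^*y$. Let $A_\phi=\overline{\phi(C_0(\mathbb R))A}$, the closed linear span of the products $\phi(f)a$ ($f\in C_0(\mathbb R)$, $a\in A$); it is a closed right ideal, i.e. a closed Hilbert $A$-submodule of $A$. Then: 1. $A_\phi$ is graded, i.e. $A_\phi=(A_\phi\cap A_0)\oplus(A_\phi\cap A_1)$, and $\phi$-invariant, i.e. $\phi(f)A_\phi\subseteq A_\phi$ for all $f\in C_0(\mathbb R)$. 2. There is a self-adjoint regular operator $D$ on $A_\phi$ of degree one with $\phi(f)|_{A_\phi}=f(D)$ for all $f\in C_0(\mathbb R)$. Moreover $D$ is the closure of the operator $\phi(f)a\mapsto\phi(d\cdot f)a$, where $d(t)=t$, defined on the linear span of the $\phi(f)a$ with $f\in C_c(\mathbb R)$ and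 $a\in A$: the graph of $D$ is the closure in $A\times A$ of the linear span of the pairs $(\phi(f)a,\phi(d\cdot f)a)$. 3. $A_\phi$ is maximal: if $E\subseteq A$ is any $\phi$-invariant closed graded Hilbert $A$-submodule that carries a self-adjoint regular operator $D'$ of degree one with $\phi(f)|_E=f(D')$ for all $f\in C_0(\mathbb R)$, then $E\subseteq A_\phi$. Here a regular operator on a Hilbert $A$-module $E$ is a densely defined closed $A$-linear map $D:\operatorname{Dom}(D)\to E$ such that $D^*$ is densely defined and $1+D^*D$ has dense range. It is self-adjoint if $D^*=D$. It has degree one if $\operatorname{Dom}(D)$ is graded and $D$ maps homogeneous elements of degree $n$ to homogeneous elements of degree $n+1 \pmod 2$. For self-adjoint regular $D$ and $f\in C_0(\mathbb R)$, $f(D)$ is the element of the $C^*$-algebra $\mathcal L(E)$ of adjointable operators given by the functional calculus: $f(D)=g((D+i)^{-1})$, where $g((t+i)^{-1})=f(t)$ for $t\in\mathbb R$ and $g(0)=0$. -/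

import Mathlib

open scoped ZeroAtInfty

/-! ### Graded C*-algebras and graded homomorphisms

A grading on a C*-algebra `A` is a *-automorphism `α` with `α ∘ α = id`; degrees are natural
numbers read modulo 2, through the sign `(-1) ^ n`. -/

/-- `x` is homogeneous of degree `n` (mod 2) for the grading automorphism `α`. -/
def HasDegree {A : Type*} [NonUnitalCStarAlgebra A] (α : A ≃⋆ₐ[ℂ] A) (n : ℕ) (x : A) : Prop :=
  α x = (-1 : ℂ) ^ n • x

/-- The even-odd grading of `C₀(ℝ)`: degree `0` (mod 2) is even, degree `1` (mod 2) is odd. -/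
def HasParity (n : ℕ) (f : C₀(ℝ, ℂ)) : Prop :=
  ∀ t : ℝ, f (-t) = (-1 : ℂ) ^ n * f t

/-- A *-homomorphism `C₀(ℝ) → A` is graded if it preserves degrees. -/
def IsGradedHom {A : Type*} [NonUnitalCStarAlgebra A] (α : A ≃⋆ₐ[ℂ] A)
    (φ : C₀(ℝ, ℂ) →⋆ₙₐ[ℂ] A) : Prop :=
  ∀ (n : ℕ) (f : C₀(ℝ, ℂ)), HasParity n f → HasDegree α n (φ f)

/-! ### Closed Hilbert submodules of `A` -/

/-- A closed Hilbert `A`-submodule of the right Hilbert `A`-module `A`, whose inner product is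
`⟨x, y⟩ = x* y`, i.e. a closed right ideal. The Hilbert module norm `‖⟨x, x⟩‖ ^ (1 / 2)` is the
norm of `A`. -/
structure HilbertSubmodule (A : Type*) [NonUnitalCStarAlgebra A] extends Submodule ℂ A where
  mul_mem' : ∀ x ∈ carrier, ∀ a : A, x * a ∈ carrier
  isClosed' : IsClosed carrier

namespace HilbertSubmodule

variable {A : Type*} [NonUnitalCStarAlgebra A]

/-- The underlying type of a Hilbert submodule. -/
def Elem (E : HilbertSubmodule A) : Type _ := E.toSubmodule

/-- The norm on a Hilbert submodule is the norm of `A`. -/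
noncomputable instance (E : HilbertSubmodule A) : NormedAddCommGroup E.Elem :=
  inferInstanceAs (NormedAddCommGroup E.toSubmodule)

noncomputable instance (E : HilbertSubmodule A) : NormedSpace ℂ E.Elem :=
  inferInstanceAs (NormedSpace ℂ E.toSubmodule)

instance (E : HilbertSubmodule A) : CompleteSpace E.Elem :=
  E.isClosed'.completeSpace_coe

/-- The inclusion `E → A`. -/
noncomputable def incl (E : HilbertSubmodule A) : E.Elem →ₗᵢ[ℂ] A := E.toSubmodule.subtypeₗᵢ

theorem incl_mem (E : HilbertSubmodule A) (x : E.Elem) : E.incl x ∈ E.toSubmodule :=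
  Subtype.property (p := fun a => a ∈ E.toSubmodule) x

/-- The `A`-valued inner product `⟨x, y⟩ = x* y`. -/
noncomputable def ip (E : HilbertSubmodule A) (x y : E.Elem) : A := star (E.incl x) * E.incl y

/-- The right action of `A`. -/
noncomputable def rmul (E : HilbertSubmodule A) (x : E.Elem) (a : A) : E.Elem :=
  (⟨E.incl x * a, E.mul_mem' _ (E.incl_mem x) a⟩ : E.toSubmodule)

/-- `E` is graded: `E = (E ∩ A₀) ⊕ (E ∩ A₁)`. -/
def IsGraded (E : HilbertSubmodule A) (α : A ≃⋆ₐ[ℂ] A) : Prop :=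
  ∀ x : E.Elem, ∃ x₀ x₁ : E.Elem,
    HasDegree α 0 (E.incl x₀) ∧ HasDegree α 1 (E.incl x₁) ∧ x = x₀ + x₁

/-- `E` is `φ`-invariant: left multiplication by each `φ f` maps `E` to itself. -/
def IsInvariant (E : HilbertSubmodule A) (φ : C₀(ℝ, ℂ) →⋆ₙₐ[ℂ] A) : Prop :=
  ∀ (f : C₀(ℝ, ℂ)) (x : E.Elem), φ f * E.incl x ∈ E.toSubmodule

theorem ip_self_norm (E : HilbertSubmodule A) (x : E.Elem) : ‖E.ip x x‖ = ‖x‖ * ‖x‖ := by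
  rw [ip, CStarRing.norm_star_mul_self, LinearIsometry.norm_map]

theorem ip_norm_le (E : HilbertSubmodule A) (x y : E.Elem) : ‖E.ip x y‖ ≤ ‖x‖ * ‖y‖ :=
  (norm_mul_le _ _).trans_eq (by simp)

theorem ip_sub_right (E : HilbertSubmodule A) (x y z : E.Elem) :
    E.ip x (y - z) = E.ip x y - E.ip x z := by
  simp [ip, mul_sub]

theorem star_ip (E : HilbertSubmodule A) (x y : E.Elem) : star (E.ip x y) = E.ip y x := by
  simp [ip]

theorem ext_ip (E : HilbertSubmodule A) {y z : E.Elem} (h : ∀ x, E.ip x y = E.ip x z) :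
    y = z := by
  have h1 : ‖E.ip (y - z) (y - z)‖ = 0 := by
    rw [ip_sub_right, h, sub_self, norm_zero]
  rw [ip_self_norm, mul_self_eq_zero, norm_eq_zero, sub_eq_zero] at h1
  exact h1

/-! ### The C*-algebra `L(E)` of adjointable operators -/

/-- `S` is an adjoint of `T`: `⟨T x, y⟩ = ⟨x, S y⟩`. -/
def IsAdj (E : HilbertSubmodule A) (T S : E.Elem →L[ℂ] E.Elem) : Prop :=
  ∀ x y : E.Elem, E.ip (T x) y = E.ip x (S y)

theorem IsAdj.symm {E : HilbertSubmodule A} {T S : E.Elem →L[ℂ] E.Elem} (h : E.IsAdj T S) :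
    E.IsAdj S T := fun x y => by
  rw [← star_ip, ← h y x, star_ip]

theorem IsAdj.unique {E : HilbertSubmodule A} {T S S' : E.Elem →L[ℂ] E.Elem}
    (h : E.IsAdj T S) (h' : E.IsAdj T S') : S = S' := by
  ext1 y
  exact E.ext_ip fun x => by rw [← h, ← h']

theorem IsAdj.add {E : HilbertSubmodule A} {T S T' S' : E.Elem →L[ℂ] E.Elem}
    (h : E.IsAdj T S) (h' : E.IsAdj T' S') : E.IsAdj (T + T') (S + S') := fun x y => by
  have h1 := h x y
  have h2 := h' x y
  simp only [ip] at h1 h2 ⊢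
  simp [add_mul, mul_add, h1, h2]

theorem IsAdj.smul {E : HilbertSubmodule A} {T S : E.Elem →L[ℂ] E.Elem}
    (h : E.IsAdj T S) (c : ℂ) : E.IsAdj (c • T) (star c • S) := fun x y => by
  have h1 := h x y
  simp only [ip] at h1 ⊢
  simp [smul_mul_assoc, mul_smul_comm, h1]

theorem IsAdj.mul {E : HilbertSubmodule A} {T S T' S' : E.Elem →L[ℂ] E.Elem}
    (h : E.IsAdj T S) (h' : E.IsAdj T' S') : E.IsAdj (T * T') (S' * S) := fun x y => by
  change E.ip (T (T' x)) y = E.ip x (S' (S y))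
  rw [h, h']

theorem IsAdj.one (E : HilbertSubmodule A) : E.IsAdj 1 1 := fun _ _ => rfl

theorem IsAdj.norm_sq_le {E : HilbertSubmodule A} {T S : E.Elem →L[ℂ] E.Elem}
    (h : E.IsAdj T S) : ‖T‖ * ‖T‖ ≤ ‖S * T‖ := by
  have h1 : ‖T‖ ≤ Real.sqrt ‖S * T‖ := by
    refine ContinuousLinearMap.opNorm_le_bound _ (Real.sqrt_nonneg _) fun x => ?_
    conv_rhs => rw [← Real.sqrt_mul_self (norm_nonneg x), ← Real.sqrt_mul (norm_nonneg _)]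
    apply Real.le_sqrt_of_sq_le
    rw [sq, ← ip_self_norm, h]
    calc ‖E.ip x (S (T x))‖ ≤ ‖x‖ * ‖(S * T) x‖ := E.ip_norm_le _ _
      _ ≤ ‖x‖ * (‖S * T‖ * ‖x‖) := by gcongr; exact (S * T).le_opNorm x
      _ = ‖S * T‖ * (‖x‖ * ‖x‖) := by ring
  calc ‖T‖ * ‖T‖ ≤ Real.sqrt ‖S * T‖ * Real.sqrt ‖S * T‖ := by gcongr
    _ = ‖S * T‖ := Real.mul_self_sqrt (norm_nonneg _)

theorem IsAdj.norm_le {E : HilbertSubmodule A} {T S : E.Elem →L[ℂ] E.Elem}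
    (h : E.IsAdj T S) : ‖T‖ ≤ ‖S‖ := by
  rcases (norm_nonneg T).eq_or_lt with h0 | h0
  · rw [← h0]; exact norm_nonneg S
  · exact le_of_mul_le_mul_right (h.norm_sq_le.trans (norm_mul_le S T)) h0

theorem IsAdj.norm_eq {E : HilbertSubmodule A} {T S : E.Elem →L[ℂ] E.Elem}
    (h : E.IsAdj T S) : ‖S‖ = ‖T‖ := le_antisymm h.symm.norm_le h.norm_le

/-- The algebra of bounded operators on `E` that have an adjoint (such operators are
automatically `A`-linear). -/
def adjointable (E : HilbertSubmodule A) : Subalgebra ℂ (E.Elem →L[ℂ] E.Elem) where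
  carrier := {T | ∃ S, E.IsAdj T S}
  mul_mem' := by
    rintro T T' ⟨S, h⟩ ⟨S', h'⟩
    exact ⟨_, h.mul h'⟩
  add_mem' := by
    rintro T T' ⟨S, h⟩ ⟨S', h'⟩
    exact ⟨_, h.add h'⟩
  algebraMap_mem' c := by
    rw [Algebra.algebraMap_eq_smul_one]
    exact ⟨_, (IsAdj.one E).smul c⟩

/-- The C*-algebra `L(E)` of adjointable operators, with the operator norm. -/
abbrev L (E : HilbertSubmodule A) : Type _ := E.adjointable

/-- The involution `T ↦ T*` of `L(E)`. -/
noncomputable instance (E : HilbertSubmodule A) : Star E.L where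
  star T := ⟨T.2.choose, (T : E.Elem →L[ℂ] E.Elem), T.2.choose_spec.symm⟩

theorem isAdj_star (E : HilbertSubmodule A) (T : E.L) :
    E.IsAdj (T : E.Elem →L[ℂ] E.Elem) ((star T : E.L) : E.Elem →L[ℂ] E.Elem) :=
  T.2.choose_spec

theorem star_eq (E : HilbertSubmodule A) {T S : E.L}
    (h : E.IsAdj (T : E.Elem →L[ℂ] E.Elem) (S : E.Elem →L[ℂ] E.Elem)) : star T = S :=
  Subtype.ext ((E.isAdj_star T).unique h)

noncomputable instance (E : HilbertSubmodule A) : StarRing E.L where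
  star_involutive T := E.star_eq (E.isAdj_star T).symm
  star_mul T S := E.star_eq ((E.isAdj_star T).mul (E.isAdj_star S))
  star_add T S := E.star_eq ((E.isAdj_star T).add (E.isAdj_star S))

instance (E : HilbertSubmodule A) : StarModule ℂ E.L where
  star_smul c T := E.star_eq ((E.isAdj_star T).smul c)

instance (E : HilbertSubmodule A) : CStarRing E.L where
  norm_mul_self_le T := (E.isAdj_star T).norm_sq_le

theorem isClosed_adjointable (E : HilbertSubmodule A) :
    IsClosed (E.adjointable : Set (E.Elem →L[ℂ] E.Elem)) := by
  refine isClosed_of_closure_subset fun T hT => ?_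
  obtain ⟨u, hu, hlim⟩ := mem_closure_iff_seq_limit.1 hT
  choose S hS using hu
  have hsub : ∀ m n, E.IsAdj (u m - u n) (S m - S n) := fun m n => by
    have := (hS m).add ((hS n).smul (-1))
    simpa [sub_eq_add_neg, neg_one_smul ℂ] using this
  have hc : CauchySeq S := by
    have hcu := hlim.cauchySeq
    rw [Metric.cauchySeq_iff] at hcu ⊢
    intro ε hε
    obtain ⟨N, hN⟩ := hcu ε hε
    refine ⟨N, fun m hm n hn => ?_⟩
    rw [dist_eq_norm, (hsub m n).norm_eq, ← dist_eq_norm]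
    exact hN m hm n hn
  obtain ⟨S', hS'⟩ := cauchySeq_tendsto_of_complete hc
  refine ⟨S', fun x y => ?_⟩
  have h1 : Filter.Tendsto (fun n => E.ip (u n x) y) Filter.atTop (nhds (E.ip (T x) y)) := by
    have : Filter.Tendsto (fun n => u n x) Filter.atTop (nhds (T x)) :=
      ((ContinuousLinearMap.apply ℂ E.Elem x).continuous.tendsto T).comp hlim
    have h2 := (E.incl.continuous.tendsto (T x)).comp this
    exact (h2.star).mul_const _
  have h2 : Filter.Tendsto (fun n => E.ip x (S n y)) Filter.atTop (nhds (E.ip x (S' y))) := by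
    have : Filter.Tendsto (fun n => S n y) Filter.atTop (nhds (S' y)) :=
      ((ContinuousLinearMap.apply ℂ E.Elem y).continuous.tendsto S').comp hS'
    have h2 := (E.incl.continuous.tendsto (S' y)).comp this
    exact h2.const_mul _
  simp only [fun n => hS n x y] at h1
  exact tendsto_nhds_unique h1 h2

instance (E : HilbertSubmodule A) : CompleteSpace E.L :=
  E.isClosed_adjointable.completeSpace_coe

noncomputable instance (E : HilbertSubmodule A) : CStarAlgebra E.L where

/-! ### Unbounded regular operators and their functional calculus -/

/-- The graph of the adjoint of `D`: the pairs `(y, z)` with `⟨D x, y⟩ = ⟨x, z⟩` for all `x` in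
the domain of `D`. -/
def adjointGraph (E : HilbertSubmodule A) (D : E.Elem →ₗ.[ℂ] E.Elem) :
    Submodule ℂ (E.Elem × E.Elem) where
  carrier := {p | ∀ x : D.domain, E.ip (D x) p.1 = E.ip (x : E.Elem) p.2}
  add_mem' := by
    intro p q hp hq x
    have h1 := hp x
    have h2 := hq x
    simp only [ip] at h1 h2 ⊢
    simp [mul_add, h1, h2]
  zero_mem' := by
    intro x
    simp [ip]
  smul_mem' := by
    intro c p hp x
    have h1 := hp x
    simp only [ip] at h1 ⊢
    simp [mul_smul_comm, h1]

/-- The adjoint `D*` of a densely defined operator `D`. -/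
noncomputable def adj (E : HilbertSubmodule A) (D : E.Elem →ₗ.[ℂ] E.Elem) :
    E.Elem →ₗ.[ℂ] E.Elem :=
  (E.adjointGraph D).toLinearPMap

/-- A regular operator on `E`: a densely defined closed `A`-linear operator `D` such that `D*` is
densely defined and `1 + D* D` has dense range. -/
structure IsRegular (E : HilbertSubmodule A) (D : E.Elem →ₗ.[ℂ] E.Elem) : Prop where
  dense_domain : Dense (D.domain : Set E.Elem)
  closed : D.IsClosed
  rmul_mem : ∀ (x : D.domain) (a : A), E.rmul x a ∈ D.domain
  map_rmul : ∀ (x : D.domain) (a : A), D ⟨E.rmul x a, rmul_mem x a⟩ = E.rmul (D x) a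
  dense_adj_domain : Dense ((E.adj D).domain : Set E.Elem)
  dense_range : Dense {w : E.Elem | ∃ (x : D.domain) (h : D x ∈ (E.adj D).domain),
    w = x + E.adj D ⟨D x, h⟩}

/-- `D` has degree one: its domain is a graded subspace, and `D` maps homogeneous elements of
degree `n` to homogeneous elements of degree `n + 1` (mod 2). -/
def IsDegreeOne (E : HilbertSubmodule A) (α : A ≃⋆ₐ[ℂ] A) (D : E.Elem →ₗ.[ℂ] E.Elem) : Prop :=
  (∀ x : D.domain, ∃ x₀ x₁ : D.domain,
    HasDegree α 0 (E.incl x₀) ∧ HasDegree α 1 (E.incl x₁) ∧ x = x₀ + x₁) ∧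
  ∀ (n : ℕ) (x : D.domain), HasDegree α n (E.incl x) → HasDegree α (n + 1) (E.incl (D x))

/-- `R = (D + i)⁻¹`: `R` is a two-sided inverse of `D + i : Domain(D) → E`. -/
def IsResolvent (E : HilbertSubmodule A) (D : E.Elem →ₗ.[ℂ] E.Elem) (R : E.L) : Prop :=
  (∀ x : E.Elem, ∃ h : R.1 x ∈ D.domain, D ⟨R.1 x, h⟩ + Complex.I • R.1 x = x) ∧
  ∀ y : D.domain, R.1 (D y + Complex.I • (y : E.Elem)) = y

open Classical in
/-- The resolvent `(D + i)⁻¹` in `L(E)`. For self-adjoint regular `D` it exists and is a normal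
element (the default value `0` is only for other operators). -/
noncomputable def resolvent (E : HilbertSubmodule A) (D : E.Elem →ₗ.[ℂ] E.Elem) : E.L :=
  if h : ∃ R : E.L, E.IsResolvent D R then h.choose else 0

open Classical in
/-- The functional calculus `f(D)` in `L(E)` of a self-adjoint regular operator `D`, for
`f ∈ C₀(ℝ)`. It is the continuous functional calculus `g((D + i)⁻¹)` of the normal element
`(D + i)⁻¹` of the C*-algebra `L(E)`, for the function `g` with `g((t + i)⁻¹) = f(t)` for real
`t` and `g(0) = 0`, which is continuous on the set `{(t + i)⁻¹ | t ∈ ℝ} ∪ {0}` that contains the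
spectrum. -/
noncomputable def funCalc (E : HilbertSubmodule A) (D : E.Elem →ₗ.[ℂ] E.Elem)
    (f : C₀(ℝ, ℂ)) : E.L :=
  cfcₙ (fun z : ℂ => if z = 0 then 0 else f (z⁻¹ - Complex.I).re) (E.resolvent D)

/-- `D` is a self-adjoint regular operator of degree one on `E` such that the restriction of
`φ f` to `E` is `f(D)` for all `f ∈ C₀(ℝ)`. -/
structure Generates (E : HilbertSubmodule A) (α : A ≃⋆ₐ[ℂ] A) (φ : C₀(ℝ, ℂ) →⋆ₙₐ[ℂ] A)
    (D : E.Elem →ₗ.[ℂ] E.Elem) : Prop where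
  regular : E.IsRegular D
  selfAdjoint : E.adj D = D
  degreeOne : E.IsDegreeOne α D
  funCalc_eq : ∀ (f : C₀(ℝ, ℂ)) (x : E.Elem), φ f * E.incl x = E.incl ((E.funCalc D f).1 x)

/-- The closed right ideal `A_φ`, the closure of (the linear span of) `φ(C₀(ℝ)) A`. -/
def ofHom (φ : C₀(ℝ, ℂ) →⋆ₙₐ[ℂ] A) : HilbertSubmodule A where
  toSubmodule :=
    (Submodule.span ℂ {x : A | ∃ (f : C₀(ℝ, ℂ)) (a : A), x = φ f * a}).topologicalClosure
  isClosed' := Submodule.isClosed_topologicalClosure _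
  mul_mem' := by
    intro x hx a
    refine map_mem_closure (f := fun y : A => y * a) (by fun_prop) hx ?_
    intro y hy
    induction hy using Submodule.span_induction with
    | mem y hy =>
      obtain ⟨f, b, rfl⟩ := hy
      exact Submodule.subset_span ⟨f, b * a, mul_assoc _ _ _⟩
    | zero =>
      change (0 : A) * a ∈ Submodule.span ℂ _
      rw [zero_mul]
      exact zero_mem _
    | add y z _ _ hy hz =>
      change (y + z) * a ∈ Submodule.span ℂ _
      rw [add_mul]
      exact add_mem hy hz
    | smul c y _ hy =>
      change (c • y) * a ∈ Submodule.span ℂ _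
      rw [smul_mul_assoc]
      exact Submodule.smul_mem _ c hy

end HilbertSubmodule

/-- The graph of the operator with domain `φ(C_c(ℝ)) A` given by `φ(f) a ↦ φ(d f) a`, where
`d(t) = t`: the linear span of the pairs `(φ(f) a, φ(d f) a)` with `f` compactly supported. -/
def coreGraph {A : Type*} [NonUnitalCStarAlgebra A] (φ : C₀(ℝ, ℂ) →⋆ₙₐ[ℂ] A) :
    Submodule ℂ (A × A) :=
  Submodule.span ℂ {p | ∃ (f df : C₀(ℝ, ℂ)) (a : A), HasCompactSupport f ∧
    (∀ t : ℝ, df t = t * f t) ∧ p = (φ f * a, φ df * a)}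

open Filter Topology

/-!
For `c = ± i`, the closure `D` of `φ(f) a ↦ φ(d f) a` has as resolvent `(D + c)⁻¹` the left
multiplication by `φ((t + c)⁻¹)` on `A_φ`: this comes from `(t + c)⁻¹ (d + c) f = f` and the density
of the compactly supported `f`. These two resolvents are mutually adjoint, everywhere defined and
have dense range, which forces `D` to be self-adjoint and regular. Every `f` in `C₀(ℝ)` is
`g((t + i)⁻¹)`, so left multiplication by `φ(f)` is `g((D + i)⁻¹) = f(D)`. Degree one means that
`(x, y) ↦ (α x, -α y)` preserves the graph of `D`, and the core has this symmetry because `d` is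
odd. Finally, an operator `D'` on `E` with `φ(f) = f(D')` has domain
`(D' + i)⁻¹ E = φ((t + i)⁻¹) E ⊆ A_φ`, and this domain is dense in `E`.
-/

/-! ### The function `(t + i)⁻¹` and its functional calculus -/

theorem dense_hasCompactSupport {X V : Type*} [TopologicalSpace X] [RegularSpace X]
    [LocallyCompactSpace X] [NormedAddCommGroup V] [NormedSpace ℝ V] :
    Dense {f : C₀(X, V) | HasCompactSupport f} := by
  intro f
  rw [Metric.mem_closure_iff]
  intro ε hε
  obtain ⟨K, hK, hfK⟩ : ∃ K, IsCompact K ∧ ∀ x ∉ K, ‖f x‖ < ε / 2 := by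
    have hsmall : ∀ᶠ x in cocompact X, ‖f x‖ < ε / 2 :=
      (tendsto_zero_iff_norm_tendsto_zero.1 (zero_at_infty f)).eventually_lt_const (half_pos hε)
    obtain ⟨K, hK, hKf⟩ := mem_cocompact.1 hsmall
    exact ⟨K, hK, fun x hx => hKf hx⟩
  obtain ⟨χ, hχK, -, hχ, hχ01⟩ :=
    exists_continuous_one_zero_of_isCompact hK isClosed_empty (Set.disjoint_empty K)
  have hχf : HasCompactSupport fun x => χ x • f x := hχ.smul_right
  refine ⟨⟨⟨fun x => χ x • f x, by fun_prop⟩, hχf.is_zero_at_infty⟩, hχf, ?_⟩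
  rw [← ZeroAtInftyContinuousMap.dist_toBCF_eq_dist]
  refine ((BoundedContinuousFunction.dist_le (half_pos hε).le).2 fun x => ?_).trans_lt
    (half_lt_self hε)
  change dist (f x) (χ x • f x) ≤ ε / 2
  by_cases hx : x ∈ K
  · simpa [hχK hx] using (half_pos hε).le
  · obtain ⟨hχ0, hχ1⟩ := hχ01 x
    calc dist (f x) (χ x • f x) = (1 - χ x) * ‖f x‖ := by
          rw [dist_eq_norm, ← Real.norm_of_nonneg (sub_nonneg.2 hχ1), ← norm_smul, sub_smul,
            one_smul]
      _ ≤ 1 * ‖f x‖ := by gcongr; linarith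
      _ ≤ ε / 2 := by rw [one_mul]; exact (hfK x hx).le

theorem ofReal_add_I_ne_zero (t : ℝ) : (t : ℂ) + Complex.I ≠ 0 := fun h => by
  simpa using congrArg Complex.im h

/-- The function `t ↦ (t + i)⁻¹` in `C₀(ℝ)`, which the functional calculus of a self-adjoint
operator `D` sends to the resolvent `(D + i)⁻¹`. -/
noncomputable def resolventFun : C₀(ℝ, ℂ) where
  toFun t := (t + Complex.I)⁻¹
  continuous_toFun := Continuous.inv₀ (by fun_prop) ofReal_add_I_ne_zero
  zero_at_infty' := by
    have h : Tendsto (fun t : ℝ => (t : ℂ) + Complex.I) (cocompact ℝ) (Bornology.cobounded ℂ) := by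
      refine (tendsto_add_const_cobounded Complex.I).comp ?_
      rw [← Metric.cobounded_eq_cocompact]
      exact RCLike.tendsto_ofReal_cobounded_cobounded ℂ
    exact tendsto_inv₀_cobounded.comp h

theorem resolventFun_apply (t : ℝ) : resolventFun t = ((t : ℂ) + Complex.I)⁻¹ := rfl

theorem add_I_mul_resolventFun (t : ℝ) : (t + Complex.I) * resolventFun t = 1 :=
  mul_inv_cancel₀ (ofReal_add_I_ne_zero t)

section MulResolvent

variable {r : C₀(ℝ, ℂ)} {c : ℂ}

theorem add_star_mul_star_apply (hr : ∀ t : ℝ, (t + c) * r t = 1) (t : ℝ) :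
    (t + star c) * (star r) t = 1 := by
  simpa [mul_comm] using congrArg star (hr t)

theorem resolvent_mul_add_smul (hr : ∀ t : ℝ, (t + c) * r t = 1) {f df : C₀(ℝ, ℂ)}
    (hdf : ∀ t : ℝ, df t = t * f t) : r * (df + c • f) = f := by
  ext t
  simp only [ZeroAtInftyContinuousMap.mul_apply, ZeroAtInftyContinuousMap.add_apply,
    ZeroAtInftyContinuousMap.smul_apply, hdf, smul_eq_mul]
  linear_combination f t * hr t

theorem sub_smul_resolvent_mul_apply (hr : ∀ t : ℝ, (t + c) * r t = 1) (f : C₀(ℝ, ℂ)) (t : ℝ) :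
    (f - c • (r * f)) t = t * (r * f) t := by
  simp only [ZeroAtInftyContinuousMap.mul_apply, ZeroAtInftyContinuousMap.sub_apply,
    ZeroAtInftyContinuousMap.smul_apply, smul_eq_mul]
  linear_combination -f t * hr t

theorem denseRange_resolvent_mul (hr : ∀ t : ℝ, (t + c) * r t = 1) :
    DenseRange fun f : C₀(ℝ, ℂ) => r * f := by
  refine dense_hasCompactSupport.mono fun f (hf : HasCompactSupport f) => ?_
  let df : C₀(ℝ, ℂ) :=
    { toFun := fun t => t * f t
      continuous_toFun := Complex.continuous_ofReal.mul (map_continuous f)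
      zero_at_infty' := (hf.mul_left (f := fun t : ℝ => (t : ℂ))).is_zero_at_infty }
  exact ⟨df + c • f, resolvent_mul_add_smul hr fun _ => rfl⟩

end MulResolvent

theorem resolventFun_sub_star :
    resolventFun - star resolventFun = (-2 * Complex.I) • (resolventFun * star resolventFun) := by
  ext t
  have h := add_I_mul_resolventFun t
  have hstar := add_star_mul_star_apply add_I_mul_resolventFun t
  rw [Complex.star_def, Complex.conj_I] at hstar
  simp only [ZeroAtInftyContinuousMap.sub_apply, ZeroAtInftyContinuousMap.smul_apply,
    ZeroAtInftyContinuousMap.mul_apply, smul_eq_mul]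
  linear_combination (star resolventFun : C₀(ℝ, ℂ)) t * h - resolventFun t * hstar

/-- The circle `{(t + i)⁻¹ | t ∈ ℝ} ∪ {0}`. It is cut out by the relation between a resolvent
`z = (t + i)⁻¹` and its conjugate, so that this relation in a C⋆-algebra confines the spectrum. -/
def resolventCircle : Set ℂ := {z | z - star z = -2 * Complex.I * (z * star z)}

/-- The function `g` with `g ((t + i)⁻¹) = f t` and `g 0 = 0`, for which `f(D) = g((D + i)⁻¹)`. It
is meant for `z` in `resolventCircle`; elsewhere the value depends on `(z⁻¹).re` only. -/
noncomputable def onResolventCircle (f : ℝ → ℂ) (z : ℂ) : ℂ :=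
  if z = 0 then 0 else f (z⁻¹ - Complex.I).re

@[simp] theorem onResolventCircle_zero (f : ℝ → ℂ) : onResolventCircle f 0 = 0 := if_pos rfl

theorem onResolventCircle_of_ne_zero (f : ℝ → ℂ) {z : ℂ} (hz : z ≠ 0) :
    onResolventCircle f z = f (z⁻¹ - Complex.I).re := if_neg hz

theorem ofReal_re_inv_sub_I {z : ℂ} (hz : z ∈ resolventCircle) (hz0 : z ≠ 0) :
    ((z⁻¹ - Complex.I).re : ℂ) = z⁻¹ - Complex.I := by
  have him : z.im = -Complex.normSq z := by
    have := congrArg Complex.im (show z - star z = -2 * Complex.I * (z * star z) from hz)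
    simp only [Complex.star_def, Complex.mul_conj, Complex.sub_im, Complex.conj_im, neg_mul,
      Complex.neg_im, Complex.mul_im, Complex.mul_re, Complex.re_ofNat, Complex.I_re,
      Complex.im_ofNat, Complex.I_im, Complex.ofReal_im, Complex.ofReal_re] at this
    linarith
  have hinv : (z⁻¹).im = 1 := by
    rw [Complex.inv_im, him, neg_neg, div_self (Complex.normSq_pos.2 hz0).ne']
  exact Complex.ext rfl (by simp [hinv])

theorem onResolventCircle_inv_add_I (f : ℝ → ℂ) (t : ℝ) :
    onResolventCircle f (t + Complex.I)⁻¹ = f t := by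
  rw [onResolventCircle_of_ne_zero f (inv_ne_zero (ofReal_add_I_ne_zero t))]
  simp

theorem onResolventCircle_resolventFun {z : ℂ} (hz : z ∈ resolventCircle) :
    onResolventCircle resolventFun z = z := by
  rcases eq_or_ne z 0 with rfl | hz0
  · exact onResolventCircle_zero _
  · rw [onResolventCircle_of_ne_zero _ hz0, resolventFun_apply, ofReal_re_inv_sub_I hz hz0,
      sub_add_cancel, inv_inv]

theorem tendsto_re_inv_sub_I_cocompact :
    Tendsto (fun z : ℂ => (z⁻¹ - Complex.I).re) (𝓝[resolventCircle \ {0}] 0) (cocompact ℝ) := by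
  rw [← Metric.cobounded_eq_cocompact, ← tendsto_norm_atTop_iff_cobounded]
  have h : Tendsto (fun z : ℂ => ‖z⁻¹ - Complex.I‖) (𝓝[≠] 0) atTop :=
    tendsto_norm_cobounded_atTop.comp
      ((tendsto_sub_const_cobounded Complex.I).comp tendsto_inv₀_nhdsNE_zero)
  refine (h.mono_left (nhdsWithin_mono _ fun z hz => hz.2)).congr' ?_
  filter_upwards [self_mem_nhdsWithin] with z hz
  rw [← ofReal_re_inv_sub_I hz.1 hz.2, Complex.norm_real, Complex.ofReal_re]

theorem continuousOn_onResolventCircle (f : C₀(ℝ, ℂ)) :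
    ContinuousOn (onResolventCircle f) resolventCircle := by
  intro z _
  rcases eq_or_ne z 0 with rfl | hz0
  · rw [← continuousWithinAt_sdiff_self, ContinuousWithinAt, onResolventCircle_zero]
    refine ((zero_at_infty f).comp tendsto_re_inv_sub_I_cocompact).congr' ?_
    filter_upwards [self_mem_nhdsWithin] with w hw
    exact (onResolventCircle_of_ne_zero f hw.2).symm
  · have h : ContinuousAt (fun w : ℂ => f (w⁻¹ - Complex.I).re) z :=
      (map_continuous f).continuousAt.comp'
        (Complex.continuous_re.continuousAt.comp' ((continuousAt_inv₀ hz0).sub continuousAt_const))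
    refine (h.congr ?_).continuousWithinAt
    filter_upwards [isOpen_ne.mem_nhds hz0] with w hw
    exact (onResolventCircle_of_ne_zero f hw).symm

theorem quasispectrum_subset_resolventCircle {B : Type*} [NonUnitalCStarAlgebra B] (b : B)
    [IsStarNormal b] (hb : b - star b = (-2 * Complex.I) • (b * star b)) :
    quasispectrum ℂ b ⊆ resolventCircle := by
  have h : cfcₙ (fun z : ℂ => z - star z) b
      = cfcₙ (fun z : ℂ => -2 * Complex.I * (z * star z)) b := by
    rw [cfcₙ_sub (fun z : ℂ => z) (fun z => star z) b,
      cfcₙ_const_mul (-2 * Complex.I) (fun z : ℂ => z * star z) b,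
      cfcₙ_mul (fun z : ℂ => z) (fun z => star z) b, cfcₙ_id' ℂ b, cfcₙ_star_id b, hb]
  exact (cfcₙ_eq_cfcₙ_iff_eqOn (R := ℂ) (a := b)).1 h

/-- Evaluation at a point, as a character of `C₀(ℝ)`. -/
noncomputable def evalStarHom (t : ℝ) : C₀(ℝ, ℂ) →⋆ₙₐ[ℂ] ℂ where
  toFun f := f t
  map_smul' _ _ := rfl
  map_zero' := rfl
  map_add' _ _ := rfl
  map_mul' _ _ := rfl
  map_star' _ := rfl

instance isStarNormal_of_comm {B : Type*} [NonUnitalCommRing B] [Star B] (b : B) :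
    IsStarNormal b := ⟨mul_comm _ _⟩

open scoped CStarAlgebra in
theorem map_cfcₙ_resolventFun {B : Type*} [NonUnitalCStarAlgebra B] (π : C₀(ℝ, ℂ) →⋆ₙₐ[ℂ] B)
    (f : C₀(ℝ, ℂ)) :
    π (cfcₙ (onResolventCircle f) resolventFun) = cfcₙ (onResolventCircle f) (π resolventFun) :=
  have : IsStarNormal (π resolventFun) := IsStarNormal.map π resolventFun
  π.map_cfcₙ (onResolventCircle f) resolventFun
    ((continuousOn_onResolventCircle f).mono
      (quasispectrum_subset_resolventCircle _ resolventFun_sub_star))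

theorem cfcₙ_resolventFun (f : C₀(ℝ, ℂ)) : cfcₙ (onResolventCircle f) resolventFun = f := by
  ext t
  have hcont : ContinuousOn (onResolventCircle f) (quasispectrum ℂ (resolventFun t)) :=
    (continuousOn_onResolventCircle f).mono (quasispectrum_subset_resolventCircle _
      (congrArg (evalStarHom t) resolventFun_sub_star))
  calc (cfcₙ (onResolventCircle f) resolventFun : C₀(ℝ, ℂ)) t
      = cfcₙ (onResolventCircle f) (resolventFun t) := map_cfcₙ_resolventFun (evalStarHom t) f
    _ = cfc (onResolventCircle f) (algebraMap ℂ ℂ (resolventFun t)) := cfcₙ_eq_cfc hcont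
    _ = onResolventCircle f (resolventFun t) := cfc_algebraMap _ _
    _ = f t := onResolventCircle_inv_add_I f t

theorem cfcₙ_map_resolventFun {B : Type*} [NonUnitalCStarAlgebra B] (π : C₀(ℝ, ℂ) →⋆ₙₐ[ℂ] B)
    (f : C₀(ℝ, ℂ)) : cfcₙ (onResolventCircle f) (π resolventFun) = π f := by
  rw [← map_cfcₙ_resolventFun, cfcₙ_resolventFun]

/-! ### Resolvents of unbounded operators -/

section Resolvent

variable {𝕜 X : Type*} [CommRing 𝕜] [AddCommGroup X] [Module 𝕜 X] [TopologicalSpace X]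

/-- `R` is the resolvent `(D + c)⁻¹`, an everywhere defined two-sided inverse of
`D + c : Domain(D) → X`. Both inverse laws are packed into one description of the graph of `D`. -/
def IsResolventAt (D : X →ₗ.[𝕜] X) (c : 𝕜) (R : X →L[𝕜] X) : Prop :=
  ∀ x y : X, (x, y) ∈ D.graph ↔ R (y + c • x) = x

namespace IsResolventAt

variable {D : X →ₗ.[𝕜] X} {c d : 𝕜} {R S : X →L[𝕜] X}

theorem apply_mem_graph (h : IsResolventAt D c R) (y : X) : (R y, y - c • R y) ∈ D.graph := by
  rw [h, sub_add_cancel]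

theorem apply_mem_domain (h : IsResolventAt D c R) (y : X) : R y ∈ D.domain :=
  LinearPMap.mem_domain_of_mem_graph (h.apply_mem_graph y)

theorem range_eq (h : IsResolventAt D c R) : Set.range R = D.domain := by
  ext x
  constructor
  · rintro ⟨y, rfl⟩
    exact h.apply_mem_domain y
  · intro hx
    exact ⟨_, (h _ _).1 (D.mem_graph ⟨x, hx⟩)⟩

theorem resolvent_identity (hR : IsResolventAt D c R) (hS : IsResolventAt D d S) (y : X) :
    R y = S y + (d - c) • S (R y) := by
  have h := (hS _ _).1 (hR.apply_mem_graph y)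
  rw [← map_smul, ← map_add]
  convert h.symm using 2
  module

theorem apply_comm (hR : IsResolventAt D c R) (hS : IsResolventAt D d S) (hcd : IsUnit (d - c))
    (y : X) : R (S y) = S (R y) := by
  have hRS := hR.resolvent_identity hS y
  have hSR := hS.resolvent_identity hR y
  refine hcd.smul_left_cancel.1 ?_
  linear_combination (norm := module) hRS + hSR

theorem eq_of_same_operator (hR : IsResolventAt D c R) (hS : IsResolventAt D c S) : R = S := by
  ext y
  rw [hR.resolvent_identity hS y, sub_self, zero_smul, add_zero]

theorem eq_of_same_resolvent {D' : X →ₗ.[𝕜] X} (h : IsResolventAt D c R)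
    (h' : IsResolventAt D' c R) : D = D' :=
  LinearPMap.eq_of_eq_graph (Submodule.ext fun p => (h p.1 p.2).trans (h' p.1 p.2).symm)

theorem isClosed [T2Space X] [ContinuousAdd X] [ContinuousConstSMul 𝕜 X]
    (h : IsResolventAt D c R) : D.IsClosed := by
  have hgraph : (D.graph : Set (X × X)) = {p | R (p.2 + c • p.1) = p.1} :=
    Set.ext fun p => h p.1 p.2
  rw [LinearPMap.IsClosed, hgraph]
  exact isClosed_eq (by fun_prop) (by fun_prop)

end IsResolventAt

end Resolvent

theorem exists_isResolventAt {𝕜 X : Type*} [NontriviallyNormedField 𝕜] [NormedAddCommGroup X]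
    [NormedSpace 𝕜 X] [CompleteSpace X] {D : X →ₗ.[𝕜] X} {c : 𝕜} {K : ℝ} (hD : D.IsClosed)
    (hbound : ∀ x : D.domain, ‖(x : X)‖ ≤ K * ‖D x + c • (x : X)‖)
    (hdense : DenseRange fun x : D.domain => D x + c • (x : X)) :
    ∃ R : X →L[𝕜] X, IsResolventAt D c R := by
  have : CompleteSpace D.graph := hD.completeSpace_coe
  let T : D.graph →L[𝕜] X :=
    (ContinuousLinearMap.snd 𝕜 X X + c • ContinuousLinearMap.fst 𝕜 X X).comp D.graph.subtypeL
  have hfst (p : D.graph) : ‖p.1.1‖ ≤ K * ‖T p‖ := by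
    obtain ⟨x, hx, hDx⟩ := D.mem_graph_iff.1 p.2
    have h := hbound x
    rwa [hx, hDx] at h
  have hanti : AntilipschitzWith (max K (1 + ‖c‖ * K)).toNNReal T := by
    refine AddMonoidHomClass.antilipschitz_of_bound T fun p => ?_
    have hsnd : ‖p.1.2‖ ≤ (1 + ‖c‖ * K) * ‖T p‖ :=
      calc ‖p.1.2‖ = ‖T p - c • p.1.1‖ := congrArg norm (add_sub_cancel_right _ _).symm
        _ ≤ ‖T p‖ + ‖c‖ * ‖p.1.1‖ := (norm_sub_le _ _).trans_eq (by rw [norm_smul])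
        _ ≤ ‖T p‖ + ‖c‖ * (K * ‖T p‖) := by gcongr; exact hfst p
        _ = (1 + ‖c‖ * K) * ‖T p‖ := by ring
    refine (max_le_max (hfst p) hsnd).trans ?_
    rw [← max_mul_of_nonneg _ _ (norm_nonneg _)]
    gcongr
    exact Real.le_coe_toNNReal _
  have hsurj : Function.Surjective T := by
    rw [← Set.range_eq_univ, ← (hanti.isClosed_range T.uniformContinuous).closure_eq]
    exact (hdense.mono (by rintro _ ⟨x, rfl⟩; exact ⟨⟨_, D.mem_graph x⟩, rfl⟩)).closure_eq
  let e := ContinuousLinearEquiv.ofBijective T (LinearMap.ker_eq_bot.2 hanti.injective)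
    (LinearMap.range_eq_top.2 hsurj)
  refine ⟨(ContinuousLinearMap.fst 𝕜 X X ∘L D.graph.subtypeL) ∘L e.symm.toContinuousLinearMap,
    fun x y => ⟨fun hxy => ?_, fun hxy => ?_⟩⟩
  · exact congrArg (fun p : D.graph => p.1.1) (e.symm_apply_apply ⟨(x, y), hxy⟩)
  · have hx : (e.symm (y + c • x)).1.1 = x := hxy
    have he : (e.symm (y + c • x)).1.2 + c • (e.symm (y + c • x)).1.1 = y + c • x :=
      e.apply_symm_apply _
    rw [hx, add_left_inj] at he
    have hsymm : (e.symm (y + c • x)).1 = (x, y) := Prod.ext hx he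
    exact hsymm ▸ (e.symm (y + c • x)).2

/-! ### Self-adjointness and regularity through resolvents -/

namespace HilbertSubmodule

variable {A : Type*} [NonUnitalCStarAlgebra A] {E : HilbertSubmodule A}

theorem ip_sub_left (x y z : E.Elem) : E.ip (x - y) z = E.ip x z - E.ip y z := by
  simp [ip, sub_mul]

theorem ip_add_left (x y z : E.Elem) : E.ip (x + y) z = E.ip x z + E.ip y z := by
  simp [ip, add_mul]

theorem ip_add_right (x y z : E.Elem) : E.ip x (y + z) = E.ip x y + E.ip x z := by
  simp [ip, mul_add]

theorem ip_smul_left (c : ℂ) (x y : E.Elem) : E.ip (c • x) y = star c • E.ip x y := by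
  simp [ip, smul_mul_assoc]

theorem ip_smul_right (c : ℂ) (x y : E.Elem) : E.ip x (c • y) = c • E.ip x y := by
  simp [ip, mul_smul_comm]

theorem ip_rmul_right (x y : E.Elem) (a : A) : E.ip x (E.rmul y a) = E.ip x y * a :=
  (mul_assoc _ _ _).symm

theorem rmul_add_smul (x y : E.Elem) (c : ℂ) (a : A) :
    E.rmul (y + c • x) a = E.rmul y a + c • E.rmul x a :=
  E.ext_ip fun z => by simp only [ip_rmul_right, ip_add_right, ip_smul_right, add_mul,
    smul_mul_assoc]

theorem IsAdj.map_rmul {T S : E.Elem →L[ℂ] E.Elem} (h : E.IsAdj T S) (x : E.Elem) (a : A) :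
    T (E.rmul x a) = E.rmul (T x) a :=
  E.ext_ip fun z => by rw [← h.symm, ip_rmul_right, ip_rmul_right, h.symm]

theorem eq_zero_of_dense_of_ip_eq_zero {s : Set E.Elem} (hs : Dense s) {y : E.Elem}
    (h : ∀ x ∈ s, E.ip x y = 0) : y = 0 := by
  have hclosed : IsClosed {x : E.Elem | E.ip x y = 0} :=
    isClosed_eq ((continuous_star.comp E.incl.continuous).mul continuous_const) continuous_const
  have hy : E.ip y y = 0 := hclosed.closure_subset_iff.2 h (hs y)
  rw [← norm_eq_zero, ← mul_self_eq_zero, ← ip_self_norm, hy, norm_zero]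

section Adjoint

variable {D : E.Elem →ₗ.[ℂ] E.Elem} {R S : E.Elem →L[ℂ] E.Elem} {c : ℂ}

theorem graph_adj (hd : Dense (D.domain : Set E.Elem)) :
    (E.adj D).graph = E.adjointGraph D := by
  refine Submodule.toLinearPMap_graph_eq _ fun p hp hp0 =>
    eq_zero_of_dense_of_ip_eq_zero hd fun x hx => ?_
  rw [← hp ⟨x, hx⟩, hp0]
  simp [ip]

theorem mem_adjointGraph_iff (hR : IsResolventAt D c R) (p : E.Elem × E.Elem) :
    p ∈ E.adjointGraph D ↔ ∀ w, E.ip (w - c • R w) p.1 = E.ip (R w) p.2 := by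
  constructor
  · intro hp w
    rw [(LinearPMap.image_iff (hR.apply_mem_domain w)).2 (hR.apply_mem_graph w)]
    exact hp ⟨R w, hR.apply_mem_domain w⟩
  · intro hp x
    have hw := (hR _ _).1 (D.mem_graph x)
    simpa only [hw, add_sub_cancel_right] using hp (D x + c • (x : E.Elem))

theorem isResolventAt_adj (hR : IsResolventAt D c R) (hRS : E.IsAdj R S)
    (hd : Dense (D.domain : Set E.Elem)) : IsResolventAt (E.adj D) (star c) S := by
  intro y z
  have hshift (w : E.Elem) :
      E.ip (w - c • R w) y = E.ip (R w) z ↔ E.ip w (S (z + star c • y)) = E.ip w y := by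
    rw [← hRS, ip_sub_left, ip_smul_left, ip_add_right, ip_smul_right, sub_eq_iff_eq_add, eq_comm]
  rw [graph_adj hd, mem_adjointGraph_iff hR]
  simp only [hshift]
  exact ⟨E.ext_ip, fun h w => by rw [h]⟩

theorem adj_eq_self (hR : IsResolventAt D c R) (hS : IsResolventAt D (star c) S)
    (hRS : E.IsAdj R S) (hd : Dense (D.domain : Set E.Elem)) : E.adj D = D :=
  (isResolventAt_adj hR hRS hd).eq_of_same_resolvent hS

theorem rmul_mem_graph (hR : IsResolventAt D c R) (hRS : E.IsAdj R S) (x : D.domain) (a : A) :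
    (E.rmul x a, E.rmul (D x) a) ∈ D.graph := by
  rw [hR, ← rmul_add_smul, hRS.map_rmul, (hR _ _).1 (D.mem_graph x)]

theorem isRegular_of_isResolventAt (hR : IsResolventAt D Complex.I R)
    (hS : IsResolventAt D (star Complex.I) S) (hRS : E.IsAdj R S)
    (hd : Dense (D.domain : Set E.Elem)) : E.IsRegular D where
  dense_domain := hd
  closed := hR.isClosed
  rmul_mem x a := LinearPMap.mem_domain_of_mem_graph (rmul_mem_graph hR hRS x a)
  map_rmul x a := ((LinearPMap.image_iff _).2 (rmul_mem_graph hR hRS x a)).symm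
  dense_adj_domain := by rwa [adj_eq_self hR hS hRS hd]
  dense_range := by
    rw [adj_eq_self hR hS hRS hd]
    refine dense_univ.mono fun w _ => ?_
    -- `x = (D + i)⁻¹ (D - i)⁻¹ w` solves `x + D (D x) = w`.
    have hx := hR.apply_mem_graph (S w)
    have hDx : (S w - Complex.I • R (S w), w - R (S w)) ∈ D.graph := by
      convert sub_mem (hS.apply_mem_graph w) (D.graph.smul_mem Complex.I hx) using 1
      refine Prod.ext rfl ?_
      simp only [Complex.star_def, Complex.conj_I, Prod.snd_sub, Prod.smul_snd, smul_sub, smul_smul,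
        Complex.I_mul_I]
      module
    have hDx_eq := (LinearPMap.image_iff (LinearPMap.mem_domain_of_mem_graph hx)).2 hx
    rw [hDx_eq] at hDx
    refine ⟨_, LinearPMap.mem_domain_of_mem_graph hDx, ?_⟩
    rw [← (LinearPMap.image_iff _).2 hDx, add_sub_cancel]

end Adjoint

section SelfAdjoint

variable {D : E.Elem →ₗ.[ℂ] E.Elem} {c : ℂ}

theorem ip_comm_of_mem_graph (hd : Dense (D.domain : Set E.Elem)) (hD : E.adj D = D)
    {p q : E.Elem × E.Elem} (hp : p ∈ D.graph) (hq : q ∈ D.graph) :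
    E.ip p.2 q.1 = E.ip p.1 q.2 := by
  obtain ⟨x, hx, hDx⟩ := D.mem_graph_iff.1 hp
  rw [← hD, graph_adj hd] at hq
  rw [← hx, ← hDx]
  exact hq x

theorem isAdj_of_isResolventAt (hd : Dense (D.domain : Set E.Elem)) (hD : E.adj D = D)
    {R S : E.Elem →L[ℂ] E.Elem} (hR : IsResolventAt D c R) (hS : IsResolventAt D (star c) S) :
    E.IsAdj R S := by
  intro x y
  have h := ip_comm_of_mem_graph hd hD (hR.apply_mem_graph x) (hS.apply_mem_graph y)
  rw [ip_sub_left, ip_sub_right, ip_smul_left, ip_smul_right, sub_left_inj] at h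
  exact h.symm

theorem norm_smul_le_norm_apply_add_smul (hd : Dense (D.domain : Set E.Elem))
    (hD : E.adj D = D) (hc : star c = -c) (x : D.domain) :
    ‖c • (x : E.Elem)‖ ≤ ‖D x + c • (x : E.Elem)‖ := by
  let _ := CStarAlgebra.spectralOrder A
  have := CStarAlgebra.spectralOrderedRing A
  have hsym := ip_comm_of_mem_graph hd hD (D.mem_graph x) (D.mem_graph x)
  have hpyth : E.ip (D x + c • (x : E.Elem)) (D x + c • (x : E.Elem))
      = E.ip (D x) (D x) + E.ip (c • (x : E.Elem)) (c • (x : E.Elem)) := by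
    simp only [ip_add_left, ip_add_right, ip_smul_left, ip_smul_right, hsym, hc]
    module
  have hle : ‖E.ip (c • (x : E.Elem)) (c • (x : E.Elem))‖
      ≤ ‖E.ip (D x + c • (x : E.Elem)) (D x + c • (x : E.Elem))‖ := by
    rw [hpyth]
    exact CStarAlgebra.norm_le_norm_of_nonneg_of_le (star_mul_self_nonneg _)
      (le_add_of_nonneg_left (star_mul_self_nonneg _))
  rw [ip_self_norm, ip_self_norm] at hle
  exact (mul_self_le_mul_self_iff (norm_nonneg _) (norm_nonneg _)).2 hle

theorem denseRange_apply_add_smul (hreg : E.IsRegular D) (hD : E.adj D = D) (hc : c * c = -1) :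
    DenseRange fun x : D.domain => D x + c • (x : E.Elem) := by
  refine hreg.dense_range.mono ?_
  rintro _ ⟨x, hDx, rfl⟩
  have hD2 : (D x, E.adj D ⟨D x, hDx⟩) ∈ (E.adj D).graph :=
    (E.adj D).mem_graph ⟨D x, hDx⟩
  generalize E.adj D ⟨D x, hDx⟩ = z at hD2 ⊢
  rw [hD] at hD2
  -- `(D + c) (D - c) x = x + D (D x)`
  obtain ⟨y, hy, hDy⟩ := D.mem_graph_iff.1 (sub_mem hD2 (D.graph.smul_mem c (D.mem_graph x)))
  refine ⟨y, ?_⟩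
  simp only [hy, hDy, Prod.fst_sub, Prod.snd_sub, Prod.smul_fst, Prod.smul_snd, smul_sub,
    smul_smul, hc]
  module

theorem exists_isResolventAt_of_isRegular (hreg : E.IsRegular D) (hD : E.adj D = D)
    (hstar : star c = -c) (hc : c * c = -1) :
    ∃ R : E.Elem →L[ℂ] E.Elem, IsResolventAt D c R := by
  have hnorm : ‖c‖ = 1 := by
    have h := congrArg norm hc
    rw [norm_mul, norm_neg, norm_one] at h
    nlinarith [norm_nonneg c]
  refine exists_isResolventAt (K := 1) hreg.closed (fun x => ?_)
    (denseRange_apply_add_smul hreg hD hc)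
  have h := norm_smul_le_norm_apply_add_smul hreg.dense_domain hD hstar x
  rwa [norm_smul, hnorm, one_mul, ← one_mul ‖D x + _‖] at h

theorem exists_isResolventAt_star (hreg : E.IsRegular D) (hD : E.adj D = D) :
    ∃ R : E.L, IsResolventAt D Complex.I R.1 ∧ IsResolventAt D (star Complex.I) (star R).1 := by
  obtain ⟨R, hR⟩ := exists_isResolventAt_of_isRegular (c := Complex.I) hreg hD (by simp) (by simp)
  obtain ⟨S, hS⟩ :=
    exists_isResolventAt_of_isRegular (c := star Complex.I) hreg hD (by simp) (by simp)
  have hRS := isAdj_of_isResolventAt hreg.dense_domain hD hR hS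
  refine ⟨⟨R, S, hRS⟩, hR, ?_⟩
  rwa [E.star_eq (S := ⟨S, R, hRS.symm⟩) hRS]

end SelfAdjoint

section FunctionalCalculus

variable {D : E.Elem →ₗ.[ℂ] E.Elem} {R : E.L}

theorem isResolvent_iff : E.IsResolvent D R ↔ IsResolventAt D Complex.I R.1 := by
  constructor
  · rintro ⟨hright, hleft⟩ x y
    constructor
    · intro hxy
      obtain ⟨x', rfl, rfl⟩ := D.mem_graph_iff.1 hxy
      exact hleft x'
    · intro hx
      obtain ⟨hdom, heq⟩ := hright (y + Complex.I • x)
      rw [← LinearPMap.image_iff (hx ▸ hdom)]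
      simpa only [hx, add_left_inj, eq_comm] using heq
  · intro h
    refine ⟨fun x => ⟨h.apply_mem_domain x, ?_⟩, fun y => (h _ _).1 (D.mem_graph y)⟩
    rw [← (LinearPMap.image_iff _).2 (h.apply_mem_graph x), sub_add_cancel]

theorem resolvent_eq (h : IsResolventAt D Complex.I R.1) : E.resolvent D = R := by
  have hex : ∃ R : E.L, E.IsResolvent D R := ⟨R, isResolvent_iff.2 h⟩
  rw [resolvent, dif_pos hex]
  exact Subtype.ext ((isResolvent_iff.1 hex.choose_spec).eq_of_same_operator h)

theorem isStarNormal_of_isResolventAt (hR : IsResolventAt D Complex.I R.1)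
    (hS : IsResolventAt D (star Complex.I) (star R).1) : IsStarNormal R where
  star_comm_self := Subtype.ext (ContinuousLinearMap.ext
    fun x => hS.apply_comm hR (by simp [← two_mul]) x)

theorem sub_star_of_isResolventAt (hR : IsResolventAt D Complex.I R.1)
    (hS : IsResolventAt D (star Complex.I) (star R).1) :
    R - star R = (-2 * Complex.I) • (R * star R) := by
  refine Subtype.ext (ContinuousLinearMap.ext fun x => ?_)
  have h := hS.resolvent_identity hR x
  rw [Complex.star_def, Complex.conj_I] at h
  change R.1 x - (star R).1 x = (-2 * Complex.I) • R.1 ((star R).1 x)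
  linear_combination (norm := module) -h

theorem funCalc_resolventFun (hR : IsResolventAt D Complex.I R.1)
    (hS : IsResolventAt D (star Complex.I) (star R).1) : E.funCalc D resolventFun = R := by
  have := isStarNormal_of_isResolventAt hR hS
  calc E.funCalc D resolventFun = cfcₙ (onResolventCircle resolventFun) R := by
        rw [← resolvent_eq hR]; rfl
    _ = cfcₙ (fun z : ℂ => z) R := cfcₙ_congr fun z hz => onResolventCircle_resolventFun
        (quasispectrum_subset_resolventCircle R (sub_star_of_isResolventAt hR hS) hz)
    _ = R := cfcₙ_id' ℂ R

theorem denseRange_funCalc_resolventFun (hreg : E.IsRegular D) (hD : E.adj D = D) :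
    DenseRange (E.funCalc D resolventFun).1 := by
  obtain ⟨R, hR, hS⟩ := exists_isResolventAt_star hreg hD
  rw [funCalc_resolventFun hR hS, DenseRange, hR.range_eq]
  exact hreg.dense_domain

end FunctionalCalculus

end HilbertSubmodule

/-! ### The ideal `A_φ` and its generator -/

namespace HilbertSubmodule

variable {A : Type*} [NonUnitalCStarAlgebra A] {φ : C₀(ℝ, ℂ) →⋆ₙₐ[ℂ] A}

theorem mul_mem_ofHom (φ : C₀(ℝ, ℂ) →⋆ₙₐ[ℂ] A) (f : C₀(ℝ, ℂ)) (a : A) :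
    φ f * a ∈ (ofHom φ).toSubmodule :=
  Submodule.le_topologicalClosure _ (Submodule.subset_span ⟨f, a, rfl⟩)

open scoped CStarAlgebra in
theorem ofHom_le_of_dense {s : Set C₀(ℝ, ℂ)} (hs : Dense s) {V : Submodule ℂ A}
    (hV : IsClosed (V : Set A)) (h : ∀ f ∈ s, ∀ a : A, φ f * a ∈ V) :
    (ofHom φ).toSubmodule ≤ V := by
  refine Submodule.topologicalClosure_minimal _ (Submodule.span_le.2 ?_) hV
  rintro _ ⟨f, a, rfl⟩
  have hclosed : IsClosed {f : C₀(ℝ, ℂ) | φ f * a ∈ V} :=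
    hV.preimage ((map_continuous φ).mul continuous_const)
  exact hclosed.closure_subset_iff.2 (fun f hf => h f hf a) (hs f)

theorem ofHom_le {V : Submodule ℂ A} (hV : IsClosed (V : Set A))
    (h : ∀ (f : C₀(ℝ, ℂ)) (a : A), φ f * a ∈ V) : (ofHom φ).toSubmodule ≤ V :=
  ofHom_le_of_dense dense_univ hV fun f _ => h f

theorem isInvariant_ofHom (φ : C₀(ℝ, ℂ) →⋆ₙₐ[ℂ] A) : (ofHom φ).IsInvariant φ := by
  intro f x
  refine ofHom_le (V := (ofHom φ).toSubmodule.comap (LinearMap.mulLeft ℂ (φ f)))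
    ((ofHom φ).isClosed'.preimage (continuous_const_mul (φ f))) (fun g a => ?_)
    ((ofHom φ).incl_mem x)
  change φ f * (φ g * a) ∈ (ofHom φ).toSubmodule
  rw [← mul_assoc, ← map_mul]
  exact mul_mem_ofHom φ _ _

theorem le_ofHom_of_isRegular {E : HilbertSubmodule A} {D : E.Elem →ₗ.[ℂ] E.Elem}
    (hreg : E.IsRegular D) (hD : E.adj D = D)
    (hφ : ∀ x, φ resolventFun * E.incl x = E.incl ((E.funCalc D resolventFun).1 x)) :
    E.toSubmodule ≤ (ofHom φ).toSubmodule := by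
  have hclosed : IsClosed {y : E.Elem | E.incl y ∈ (ofHom φ).toSubmodule} :=
    (ofHom φ).isClosed'.preimage E.incl.continuous
  intro x hx
  refine hclosed.closure_subset_iff.2 ?_
    (denseRange_funCalc_resolventFun hreg hD (⟨x, hx⟩ : E.toSubmodule))
  rintro _ ⟨y, rfl⟩
  change E.incl _ ∈ (ofHom φ).toSubmodule
  rw [← hφ]
  exact mul_mem_ofHom φ _ _

section Representation

variable {E : HilbertSubmodule A} (hE : E.IsInvariant φ)

/-- Left multiplication by `φ f`, as a bounded operator on a `φ`-invariant Hilbert submodule. -/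
noncomputable def leftMul (f : C₀(ℝ, ℂ)) : E.Elem →L[ℂ] E.Elem :=
  (((ContinuousLinearMap.mul ℂ A (φ f)).comp E.incl.toContinuousLinearMap).codRestrict
    E.toSubmodule (hE f) :)

theorem incl_leftMul (f : C₀(ℝ, ℂ)) (x : E.Elem) :
    E.incl (leftMul hE f x) = φ f * E.incl x := rfl

theorem isAdj_leftMul (f : C₀(ℝ, ℂ)) : E.IsAdj (leftMul hE f) (leftMul hE (star f)) :=
  fun x y => by simp only [ip, incl_leftMul, map_star, star_mul, mul_assoc]

/-- The representation of `C₀(ℝ)` by left multiplication through `φ` on a `φ`-invariant Hilbert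
submodule. -/
noncomputable def leftRep : C₀(ℝ, ℂ) →⋆ₙₐ[ℂ] E.L where
  toFun f := ⟨leftMul hE f, _, isAdj_leftMul hE f⟩
  map_smul' c f := Subtype.ext <| ContinuousLinearMap.ext fun x => E.incl.injective <|
    (congrArg (· * E.incl x) (map_smul φ c f)).trans (smul_mul_assoc _ _ _)
  map_zero' := Subtype.ext <| ContinuousLinearMap.ext fun x => E.incl.injective <|
    (congrArg (· * E.incl x) (map_zero φ)).trans (zero_mul _)
  map_add' f g := Subtype.ext <| ContinuousLinearMap.ext fun x => E.incl.injective <|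
    (congrArg (· * E.incl x) (map_add φ f g)).trans (add_mul _ _ _)
  map_mul' f g := Subtype.ext <| ContinuousLinearMap.ext fun x => E.incl.injective <|
    (congrArg (· * E.incl x) (map_mul φ f g)).trans (mul_assoc _ _ _)
  map_star' f := (E.star_eq (isAdj_leftMul hE f)).symm

end Representation

section Generator

variable {r : C₀(ℝ, ℂ)} {c : ℂ}

theorem denseRange_leftMul (hr : ∀ t : ℝ, (t + c) * r t = 1) :
    DenseRange (leftMul (isInvariant_ofHom φ) r) := by
  let W := (leftMul (isInvariant_ofHom φ) r).range.map (ofHom φ).incl.toLinearMap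
  have hle : (ofHom φ).toSubmodule ≤ W.topologicalClosure := by
    refine ofHom_le_of_dense (denseRange_resolvent_mul hr) W.isClosed_topologicalClosure ?_
    rintro _ ⟨f, rfl⟩ a
    refine W.le_topologicalClosure
      ⟨_, ⟨(⟨φ f * a, mul_mem_ofHom φ f a⟩ : (ofHom φ).toSubmodule), rfl⟩, ?_⟩
    change φ r * (φ f * a) = φ (r * f) * a
    rw [map_mul, mul_assoc]
  intro x
  rw [(ofHom φ).incl.isometry.isEmbedding.isInducing.closure_eq_preimage_closure_image]
  exact hle ((ofHom φ).incl_mem x)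

theorem eq_zero_of_leftMul_eq_zero (hr : ∀ t : ℝ, (t + c) * r t = 1) {y : (ofHom φ).Elem}
    (hy : leftMul (isInvariant_ofHom φ) r y = 0) : y = 0 := by
  refine eq_zero_of_dense_of_ip_eq_zero (denseRange_leftMul (add_star_mul_star_apply hr)) ?_
  rintro _ ⟨x, rfl⟩
  rw [(isAdj_leftMul _ r).symm, hy]
  simp only [ip, map_zero, mul_zero]

theorem closure_coreGraph_subset (hr : ∀ t : ℝ, (t + c) * r t = 1) :
    closure (coreGraph φ : Set (A × A)) ⊆
      {p | p.2 + c • p.1 ∈ (ofHom φ).toSubmodule ∧ φ r * (p.2 + c • p.1) = p.1} := by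
  let T : A × A →L[ℂ] A := ContinuousLinearMap.snd ℂ A A + c • ContinuousLinearMap.fst ℂ A A
  have hle : coreGraph φ ≤ (ofHom φ).toSubmodule.comap T.toLinearMap ⊓
      LinearMap.eqLocus (LinearMap.mulLeft ℂ (φ r) ∘ₗ T.toLinearMap) (LinearMap.fst ℂ A A) := by
    refine Submodule.span_le.2 ?_
    rintro _ ⟨f, df, a, -, hdf, rfl⟩
    have hT : T (φ f * a, φ df * a) = φ (df + c • f) * a := by
      rw [map_add, map_smul, add_mul, smul_mul_assoc]
      rfl
    have hmem : T (φ f * a, φ df * a) ∈ (ofHom φ).toSubmodule := hT ▸ mul_mem_ofHom φ _ _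
    have hfix : φ r * T (φ f * a, φ df * a) = φ f * a := by
      rw [hT, ← mul_assoc, ← map_mul, resolvent_mul_add_smul hr hdf]
    exact ⟨hmem, hfix⟩
  exact closure_minimal hle (((ofHom φ).isClosed'.preimage T.continuous).inter
    (isClosed_eq (by fun_prop) (by fun_prop)))

theorem resolvent_pair_mem_closure_coreGraph (hr : ∀ t : ℝ, (t + c) * r t = 1) {y : A}
    (hy : y ∈ (ofHom φ).toSubmodule) :
    (φ r * y, y - c • (φ r * y)) ∈ closure (coreGraph φ : Set (A × A)) := by
  let R := ContinuousLinearMap.mul ℂ A (φ r)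
  let F : A →L[ℂ] A × A := R.prod (ContinuousLinearMap.id ℂ A - c • R)
  refine ofHom_le_of_dense (V := (coreGraph φ).topologicalClosure.comap F.toLinearMap)
    dense_hasCompactSupport
    ((Submodule.isClosed_topologicalClosure _).preimage F.continuous) (fun f hf a => ?_) hy
  refine Submodule.le_topologicalClosure _ (Submodule.subset_span
    ⟨r * f, f - c • (r * f), a, hf.mul_left, sub_smul_resolvent_mul_apply hr f, ?_⟩)
  change (φ r * (φ f * a), φ f * a - c • (φ r * (φ f * a))) = _
  rw [map_sub, map_smul, map_mul, sub_mul, smul_mul_assoc, mul_assoc]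

theorem mem_closure_coreGraph_iff (hr : ∀ t : ℝ, (t + c) * r t = 1) {p : A × A} :
    p ∈ closure (coreGraph φ : Set (A × A)) ↔
      p.2 + c • p.1 ∈ (ofHom φ).toSubmodule ∧ φ r * (p.2 + c • p.1) = p.1 := by
  refine ⟨fun hp => closure_coreGraph_subset hr hp, fun ⟨hmem, hfix⟩ => ?_⟩
  simpa only [hfix, add_sub_cancel_right] using resolvent_pair_mem_closure_coreGraph hr hmem

/-- The operator `D` on `A_φ`: the closure of `φ(f) a ↦ φ(d f) a`, with `d(t) = t` and `f`
compactly supported. `Submodule.toLinearPMap` gives an operator with another graph when its argument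
is not single-valued; `mem_graph_generator` excludes this. -/
noncomputable def generator (φ : C₀(ℝ, ℂ) →⋆ₙₐ[ℂ] A) : (ofHom φ).Elem →ₗ.[ℂ] (ofHom φ).Elem :=
  ((coreGraph φ).topologicalClosure.comap
    ((ofHom φ).incl.toLinearMap.prodMap (ofHom φ).incl.toLinearMap)).toLinearPMap

theorem mem_graph_generator {x y : (ofHom φ).Elem} :
    (x, y) ∈ (generator φ).graph ↔
      ((ofHom φ).incl x, (ofHom φ).incl y) ∈ closure (coreGraph φ : Set (A × A)) := by
  rw [generator, Submodule.toLinearPMap_graph_eq]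
  · rfl
  · intro p hp hp0
    obtain ⟨-, hfix⟩ := (mem_closure_coreGraph_iff add_I_mul_resolventFun).1 hp
    refine eq_zero_of_leftMul_eq_zero add_I_mul_resolventFun ((ofHom φ).incl.injective ?_)
    simpa [hp0, incl_leftMul] using hfix

theorem isResolventAt_generator (hr : ∀ t : ℝ, (t + c) * r t = 1) :
    IsResolventAt (generator φ) c (leftMul (isInvariant_ofHom φ) r) := by
  intro x y
  rw [mem_graph_generator, mem_closure_coreGraph_iff hr, ← (ofHom φ).incl.injective.eq_iff,
    incl_leftMul, map_add, map_smul]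
  exact and_iff_right ((ofHom φ).incl_mem (y + c • x))

theorem graph_generator_eq_closure (φ : C₀(ℝ, ℂ) →⋆ₙₐ[ℂ] A) :
    {p : A × A | ∃ x : (generator φ).domain,
      p = ((ofHom φ).incl x, (ofHom φ).incl (generator φ x))} =
      closure (coreGraph φ : Set (A × A)) := by
  ext p
  constructor
  · rintro ⟨x, rfl⟩
    exact mem_graph_generator.1 ((generator φ).mem_graph x)
  · intro hp
    obtain ⟨hmem, hfix⟩ := (mem_closure_coreGraph_iff add_I_mul_resolventFun).1 hp
    have hp1 : p.1 ∈ (ofHom φ).toSubmodule :=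
      hfix ▸ isInvariant_ofHom φ resolventFun (⟨_, hmem⟩ : (ofHom φ).toSubmodule)
    have hp2 : p.2 ∈ (ofHom φ).toSubmodule :=
      (Submodule.add_mem_iff_left _ (Submodule.smul_mem _ _ hp1)).1 hmem
    let x : (ofHom φ).Elem := (⟨p.1, hp1⟩ : (ofHom φ).toSubmodule)
    let y : (ofHom φ).Elem := (⟨p.2, hp2⟩ : (ofHom φ).toSubmodule)
    have hxy : (x, y) ∈ (generator φ).graph := mem_graph_generator.2 hp
    refine ⟨⟨x, LinearPMap.mem_domain_of_mem_graph hxy⟩, Prod.ext rfl ?_⟩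
    exact congrArg (ofHom φ).incl ((LinearPMap.image_iff _).2 hxy)

theorem dense_domain_generator (φ : C₀(ℝ, ℂ) →⋆ₙₐ[ℂ] A) :
    Dense ((generator φ).domain : Set (ofHom φ).Elem) := by
  rw [← (isResolventAt_generator add_I_mul_resolventFun).range_eq]
  exact denseRange_leftMul add_I_mul_resolventFun

theorem isRegular_generator (φ : C₀(ℝ, ℂ) →⋆ₙₐ[ℂ] A) : (ofHom φ).IsRegular (generator φ) :=
  isRegular_of_isResolventAt (isResolventAt_generator add_I_mul_resolventFun)
    (isResolventAt_generator (add_star_mul_star_apply add_I_mul_resolventFun))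
    (isAdj_leftMul _ _) (dense_domain_generator φ)

theorem adj_generator (φ : C₀(ℝ, ℂ) →⋆ₙₐ[ℂ] A) : (ofHom φ).adj (generator φ) = generator φ :=
  adj_eq_self (isResolventAt_generator add_I_mul_resolventFun)
    (isResolventAt_generator (add_star_mul_star_apply add_I_mul_resolventFun))
    (isAdj_leftMul _ _) (dense_domain_generator φ)

theorem funCalc_generator (φ : C₀(ℝ, ℂ) →⋆ₙₐ[ℂ] A) (f : C₀(ℝ, ℂ)) :
    (ofHom φ).funCalc (generator φ) f = leftRep (isInvariant_ofHom φ) f := by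
  rw [← cfcₙ_map_resolventFun (leftRep (isInvariant_ofHom φ)) f, funCalc,
    resolvent_eq (R := leftRep (isInvariant_ofHom φ) resolventFun)
      (isResolventAt_generator add_I_mul_resolventFun)]
  rfl

end Generator

end HilbertSubmodule

/-! ### Gradings -/

section Grading

variable {A : Type*} [NonUnitalCStarAlgebra A] {α : A ≃⋆ₐ[ℂ] A} {φ : C₀(ℝ, ℂ) →⋆ₙₐ[ℂ] A}

theorem hasDegree_half_add (hα : ∀ a : A, α (α a) = a) (x : A) :
    HasDegree α 0 ((2⁻¹ : ℂ) • (x + α x)) := by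
  rw [HasDegree, map_smul, map_add, hα, pow_zero, one_smul, add_comm]

theorem hasDegree_half_sub (hα : ∀ a : A, α (α a) = a) (x : A) :
    HasDegree α 1 ((2⁻¹ : ℂ) • (x - α x)) := by
  rw [HasDegree, map_smul, map_sub, hα, pow_one]
  module

/-- The grading automorphism of `C₀(ℝ)`, which sends `f` to the function `t ↦ f (-t)`. -/
noncomputable def reflect (f : C₀(ℝ, ℂ)) : C₀(ℝ, ℂ) :=
  f.comp (Homeomorph.neg ℝ).toCocompactMap

theorem reflect_apply (f : C₀(ℝ, ℂ)) (t : ℝ) : reflect f t = f (-t) := rfl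

theorem IsGradedHom.map_reflect (hφ : IsGradedHom α φ) (f : C₀(ℝ, ℂ)) :
    φ (reflect f) = α (φ f) := by
  have heven : HasDegree α 0 (φ (f + reflect f)) := hφ 0 _ fun t => by
    simp [reflect_apply, add_comm]
  have hodd : HasDegree α 1 (φ (f - reflect f)) := hφ 1 _ fun t => by
    simp [reflect_apply]
  rw [HasDegree, pow_zero, one_smul, map_add, map_add] at heven
  rw [HasDegree, pow_one, neg_one_smul, map_sub, map_sub] at hodd
  refine smul_right_injective A (two_ne_zero (α := ℂ)) ?_
  linear_combination (norm := module) -heven - hodd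

open scoped CStarAlgebra in
theorem IsGradedHom.map_mem_closure_coreGraph (hφ : IsGradedHom α φ) {p : A × A}
    (hp : p ∈ closure (coreGraph φ : Set (A × A))) :
    (α p.1, -α p.2) ∈ closure (coreGraph φ : Set (A × A)) := by
  have hα : Continuous α := map_continuous α
  let F : A × A →ₗ[ℂ] A × A := (α : A →ₗ[ℂ] A).prodMap (-(α : A →ₗ[ℂ] A))
  have hle : coreGraph φ ≤ (coreGraph φ).comap F := by
    refine Submodule.span_le.2 ?_
    rintro _ ⟨f, df, a, hf, hdf, rfl⟩
    refine Submodule.subset_span ⟨reflect f, -reflect df, α a,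
      hf.comp_homeomorph (Homeomorph.neg ℝ), fun t => ?_, ?_⟩
    · simp [reflect_apply, hdf]
    · rw [map_neg, hφ.map_reflect, hφ.map_reflect, neg_mul, ← map_mul, ← map_mul]
      rfl
  exact map_mem_closure (f := F) ((hα.comp continuous_fst).prodMk (hα.comp continuous_snd).neg)
    hp hle

namespace HilbertSubmodule

variable {E : HilbertSubmodule A}

theorem isGraded_of_forall_map_mem (hα : ∀ a : A, α (α a) = a)
    (h : ∀ x : E.Elem, α (E.incl x) ∈ E.toSubmodule) : E.IsGraded α := by
  intro x
  let y : E.Elem := (⟨_, h x⟩ : E.toSubmodule)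
  exact ⟨(2⁻¹ : ℂ) • (x + y), (2⁻¹ : ℂ) • (x - y), hasDegree_half_add hα _,
    hasDegree_half_sub hα _, by module⟩

theorem isDegreeOne_of_anticomm {D : E.Elem →ₗ.[ℂ] E.Elem} (hα : ∀ a : A, α (α a) = a)
    (h : ∀ x : D.domain, ∃ y : D.domain,
      E.incl y = α (E.incl x) ∧ E.incl (D y) = -α (E.incl (D x))) : E.IsDegreeOne α D := by
  refine ⟨fun x => ?_, fun n x hx => ?_⟩
  · obtain ⟨y, hy, -⟩ := h x
    refine ⟨(2⁻¹ : ℂ) • (x + y), (2⁻¹ : ℂ) • (x - y), ?_, ?_, by module⟩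
    · simpa [hy] using hasDegree_half_add hα (E.incl x)
    · simpa [hy] using hasDegree_half_sub hα (E.incl x)
  · obtain ⟨y, hy, hDy⟩ := h x
    have hyx : y = (-1 : ℂ) ^ n • x :=
      Subtype.ext (E.incl.injective (hy.trans (hx.trans (map_smul E.incl _ _).symm)))
    rw [hyx, LinearPMap.map_smul, map_smul] at hDy
    rw [HasDegree, pow_succ, mul_neg_one, neg_smul, hDy, neg_neg]

open scoped CStarAlgebra in
theorem isGraded_ofHom (hα : ∀ a : A, α (α a) = a) (hφ : IsGradedHom α φ) :
    (ofHom φ).IsGraded α := by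
  refine isGraded_of_forall_map_mem hα fun x => ?_
  refine ofHom_le (V := (ofHom φ).toSubmodule.comap (α : A →ₗ[ℂ] A))
    ((ofHom φ).isClosed'.preimage (map_continuous α)) (fun f a => ?_) ((ofHom φ).incl_mem x)
  change α (φ f * a) ∈ (ofHom φ).toSubmodule
  rw [map_mul, ← hφ.map_reflect]
  exact mul_mem_ofHom φ _ _

theorem isDegreeOne_generator (hα : ∀ a : A, α (α a) = a) (hφ : IsGradedHom α φ) :
    (ofHom φ).IsDegreeOne α (generator φ) := by
  refine isDegreeOne_of_anticomm hα fun x => ?_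
  have hx := hφ.map_mem_closure_coreGraph (mem_graph_generator.1 ((generator φ).mem_graph x))
  rw [← graph_generator_eq_closure] at hx
  obtain ⟨y, hy⟩ := hx
  exact ⟨y, (congrArg Prod.fst hy).symm, (congrArg Prod.snd hy).symm⟩

theorem generates_generator (hα : ∀ a : A, α (α a) = a) (hφ : IsGradedHom α φ) :
    (ofHom φ).Generates α φ (generator φ) where
  regular := isRegular_generator φ
  selfAdjoint := adj_generator φ
  degreeOne := isDegreeOne_generator hα hφ
  funCalc_eq f x := by rw [funCalc_generator]; rfl

end HilbertSubmodule

end Grading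

theorem proposition3p1_general {A : Type*} [NonUnitalCStarAlgebra A]
    (α : A ≃⋆ₐ[ℂ] A) (hα : ∀ a : A, α (α a) = a)
    (φ : C₀(ℝ, ℂ) →⋆ₙₐ[ℂ] A) (hφ : IsGradedHom α φ) :
    (HilbertSubmodule.ofHom φ).IsGraded α ∧
    (HilbertSubmodule.ofHom φ).IsInvariant φ ∧
    (∃ D : (HilbertSubmodule.ofHom φ).Elem →ₗ.[ℂ] (HilbertSubmodule.ofHom φ).Elem,
      (HilbertSubmodule.ofHom φ).Generates α φ D ∧
      {p : A × A | ∃ x : D.domain,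
        p = ((HilbertSubmodule.ofHom φ).incl x, (HilbertSubmodule.ofHom φ).incl (D x))} =
        closure (coreGraph φ : Set (A × A))) ∧
    ∀ (E : HilbertSubmodule A) (D : E.Elem →ₗ.[ℂ] E.Elem), E.IsRegular D → E.adj D = D →
      (∀ f x, φ f * E.incl x = E.incl ((E.funCalc D f).1 x)) →
      E.toSubmodule ≤ (HilbertSubmodule.ofHom φ).toSubmodule :=
  ⟨HilbertSubmodule.isGraded_ofHom hα hφ, HilbertSubmodule.isInvariant_ofHom φ,
    ⟨HilbertSubmodule.generator φ, HilbertSubmodule.generates_generator hα hφ,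
      HilbertSubmodule.graph_generator_eq_closure φ⟩,
    fun _ _ hreg hD hfunCalc =>
      HilbertSubmodule.le_ofHom_of_isRegular hreg hD (hfunCalc resolventFun)⟩

theorem proposition3p1 {A : Type*} [NonUnitalCStarAlgebra A]
    (α : A ≃⋆ₐ[ℂ] A) (hα : ∀ a : A, α (α a) = a)
    (φ : C₀(ℝ, ℂ) →⋆ₙₐ[ℂ] A) (hφ : IsGradedHom α φ) :
    (HilbertSubmodule.ofHom φ).IsGraded α ∧
    (HilbertSubmodule.ofHom φ).IsInvariant φ ∧
    (∃ D : (HilbertSubmodule.ofHom φ).Elem →ₗ.[ℂ] (HilbertSubmodule.ofHom φ).Elem,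
      (HilbertSubmodule.ofHom φ).Generates α φ D ∧
      {p : A × A | ∃ x : D.domain,
        p = ((HilbertSubmodule.ofHom φ).incl x, (HilbertSubmodule.ofHom φ).incl (D x))} =
        closure (coreGraph φ : Set (A × A))) ∧
    ∀ E : HilbertSubmodule A, E.IsGraded α → E.IsInvariant φ →
      (∃ D : E.Elem →ₗ.[ℂ] E.Elem, E.Generates α φ D) →
      E.toSubmodule ≤ (HilbertSubmodule.ofHom φ).toSubmodule :=
  have ⟨hgraded, hinv, hgen, hmax⟩ := proposition3p1_general α hα φ hφ
  ⟨hgraded, hinv, hgen, fun E _ _ ⟨D, hD⟩ => hmax E D hD.regular hD.selfAdjoint hD.funCalc_eq⟩
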